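/- Let $A$ be a unital C*-algebra, let $\mathcal{C}(A)$ be the poset of its commutative unital C*-subalgebras ordered by inclusion (with least element $\mathbb{C}\cdot 1$), and let $\mathcal{T}(A)=\mathbf{Sets}^{\mathcal{C}(A)}$ be the topos of functors $\mathcal{C}(A)\to\mathbf{Sets}$. Notation. Let $\mathbb{Q}\times_<\mathbb{Q}$ be the set of pairs $(p,q)$ of rationals with $p<q$, ordered by $(p,q)\leq(p',q')$ iff $p'\leq p$ and $q\leq q'$, with a bottom element $\bot$ added. Let $\blacktriangleleft$ be the covering relation with $\bot\blacktriangleleft U$ for all $U$, and $(p,q)\blacktriangleleft U$ iff for all rationals $p<p'<q'<q$ there is $(p'',q'')\in U$ with $(p',q')\leq(p'',q'')$. In any topos, $\mathcal{F}(L,\vartriangleleft)=\{U\in\mathcal{P}(L)\mid \forall x\,(x\vartriangleleft U\Rightarrow x\in U)\}$, ordered by inclusion. Let $\mathbb{IR}$ be the poset of compact intervals $[a,b]\subset\mathbb{R}$ ordered by reverse inclusion, with the Scott topology. Let $\mathcal{O}(\underline{\mathbb{IR}})$ be the internal frame in $\mathcal{T}(A)$ that is freely generated (in the internal sense) by symbols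 $(p,q)$, $p<q$ rational, subject to the relations $(p_1,q_1)\wedge(p_2,q_2)=(\max\{p_1,p_2\},\min\{q_1,q_2\})$ if $\max\{p_1,p_2\}<\min\{q_1,q_2\}$ and $=\bot$ otherwise; $(p,q)=\bigvee\{(p',q')\mid p<p'<q'<q\}$; $\top=\bigvee\{(p,q)\mid p<q\}$. Underlined sets denote constant functors. Proposition. 1. The object $\mathcal{F}(\underline{\mathbb{Q}\times_<\mathbb{Q}},\underline{\blacktriangleleft})$, interpreted in the internal language of $\mathcal{T}(A)$, is an internal frame under inclusion, and together with the generators $(p,q)\mapsto{\downarrow}(p,q)$ it has the universal property of $\mathcal{O}(\underline{\mathbb{IR}})$. Hence $\mathcal{O}(\underline{\mathbb{IR}})\cong\mathcal{F}(\underline{\mathbb{Q}\times_<\mathbb{Q}},\underline{\blacktriangleleft})$ as internal frames, compatibly with the generators. 2. In $\mathbf{Sets}$, the map sending a Scott open $W$ to the subset of $\mathbb{Q}\times_<\mathbb{Q}$ that consists of $\bot$ and of all $(p,q)$ with $\{[a,b]\mid p<a\leq b<q\}\subseteq W$ is an isomorphism of frames $\mathcal{O}(\mathbb{IR})\cong\mathcal{F}(\mathbb{Q}\times_<\mathbb{Q},\blacktriangleleft)$;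 through it we regard $\mathcal{O}(\mathbb{IR})$ as a subset of the power set of $\mathbb{Q}\times_<\mathbb{Q}$. Under the isomorphism of part 1, $$\mathcal{O}(\underline{\mathbb{IR}})(\mathbb{C}\cdot 1)\cong\{\underline{S}\in\mathrm{Sub}(\underline{\mathbb{Q}\times_<\mathbb{Q}})\mid \underline{S}(C)\in\mathcal{O}(\mathbb{IR})\text{ for all }C\in\mathcal{C}(A)\},$$ which is in turn isomorphic, via $\underline{S}\mapsto(C\mapsto\underline{S}(C))$, to the poset of monotone maps $\mathcal{C}(A)\to\mathcal{O}(\mathbb{IR})$ with the pointwise order. 3. For each $C\in\mathcal{C}(A)$, $\mathcal{O}(\underline{\mathbb{IR}})(C)$ is the truncation of this set to $\uparrow\! C$: it consists of the subfunctors $\underline{S}$ of $\underline{\mathbb{Q}\times_<\mathbb{Q}}_{|\uparrow C}$ with $\underline{S}(D)\in\mathcal{O}(\mathbb{IR})$ for all $D\supseteq C$, and these are exactly the restrictions to $\uparrow\! C$ of the elements of $\mathcal{O}(\underline{\mathbb{IR}})(\mathbb{C}\cdot 1)$. For $C\subseteq D$ the map $\mathcal{O}(\underline{\mathbb{IR}})(C)\to\mathcal{O}(\underline{\mathbb{IR}})(D)$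 is truncation to $\uparrow\! D$. 4. Give $\mathcal{C}(A)$ the Alexandrov topology, whose opens are the upper sets. The external description of $\mathcal{O}(\underline{\mathbb{IR}})$ is a frame map $\pi_{\mathbb{IR}}^*:\mathcal{O}(\mathcal{C}(A))\to\mathcal{O}(\underline{\mathbb{IR}})(\mathbb{C}\cdot 1)$. Here the external description is the map that sends an open $V$ to the image of the top element under the left adjoint of the restriction map from $\mathcal{O}(\underline{\mathbb{IR}})(\mathbb{C}\cdot 1)$ to the value at $V$ of the corresponding sheaf on $\mathcal{C}(A)$. It is given on basic opens by $$\pi_{\mathbb{IR}}^*(\uparrow\! D):\; E\mapsto\top\ (E\supseteq D),\qquad E\mapsto\bot\ (E\not\supseteq D),$$ where $\top$ and $\bot$ are the top and bottom elements of $\mathcal{O}(\mathbb{IR})$. -/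

import Mathlib

open CategoryTheory TopologicalSpace Topology

universe u

namespace Bohr

/-! ## The poset of contexts and the topos of functors on it -/

/-- The commutative unital C*-subalgebras of a unital C*-algebra `A`. -/
def IsContext {A : Type u} [CStarAlgebra A] (C : StarSubalgebra ℂ A) : Prop :=
  IsClosed (C : Set A) ∧ ∀ x ∈ C, ∀ y ∈ C, x * y = y * x

/-- The set `𝒞(A)` of commutative unital C*-subalgebras of `A`, ordered by inclusion. -/
abbrev Context (A : Type u) [CStarAlgebra A] : Type u :=
  {C : StarSubalgebra ℂ A // IsContext C}

theorem isContext_bot (A : Type u) [CStarAlgebra A] :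
    IsContext (⊥ : StarSubalgebra ℂ A) := by
  refine ⟨?_, ?_⟩
  · have h := (LinearMap.range (Algebra.linearMap ℂ A)).closed_of_finiteDimensional
    convert h using 1
    ext x
    simp [Algebra.linearMap_apply, Set.mem_range]
  · intro x hx y hy
    obtain ⟨a, rfl⟩ := StarSubalgebra.mem_bot.1 hx
    exact Algebra.commutes a y

/-- The least context is `ℂ · 1`. -/
instance (A : Type u) [CStarAlgebra A] : OrderBot (Context A) where
  bot := ⟨⊥, isContext_bot A⟩
  bot_le C := (bot_le : (⊥ : StarSubalgebra ℂ A) ≤ C.1)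

/-- The topos `Sets^P` of functors from a poset `P` to sets. For `P = 𝒞(A)` it is `𝒯(A)`. -/
abbrev Topos (P : Type u) [PartialOrder P] : Type (u + 1) := P ⥤ Type u

section Logic

variable {P : Type u} [PartialOrder P]

/-- The constant functor with value `S`. -/
abbrev const (P : Type u) [PartialOrder P] (S : Type u) : Topos P := (Functor.const P).obj S

/-- The restriction `X|↑C` of a functor `X` to the principal upper set `↑C`. -/
abbrev above (X : Topos P) (C : P) : Set.Ici C ⥤ Type u where
  obj D := X.obj D.1
  map i := X.map (homOfLE (leOfHom i))
  map_id D := X.map_id D.1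
  map_comp i j := X.map_comp (homOfLE (leOfHom i)) (homOfLE (leOfHom j))

/-- Truncation to `↑D` of a subfunctor of `X|↑C`, for `C ≤ D`. -/
def truncate {X : Topos P} {C D : P} (h : C ≤ D) (U : Subfunctor (above X C)) :
    Subfunctor (above X D) where
  obj E := U.obj ⟨E.1, le_trans h E.2⟩
  map {E E'} i := U.map (U := ⟨E.1, le_trans h E.2⟩) (V := ⟨E'.1, le_trans h E'.2⟩)
    (homOfLE (leOfHom i))

/-- The power object `Ω^X` of `X`: one has `Ω^X(C) = Sub(X|↑C)`, with truncation as action. -/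
def Pow (X : Topos P) : Topos P where
  obj C := Subfunctor (above X C)
  map f := ↾(truncate (leOfHom f))

/-- Direct image `Ω^X ⟶ Ω^Y` along an arrow `X ⟶ Y`. -/
def powMap {X Y : Topos P} (φ : X ⟶ Y) : Pow X ⟶ Pow Y where
  app C := ↾(fun U : Subfunctor (above X C) =>
    ({ obj := fun D => {y | ∃ x ∈ U.obj D, φ.app D.1 x = y}
       map := by
        rintro D E i _ ⟨x, hx, rfl⟩
        exact ⟨_, U.map i hx, NatTrans.naturality_apply φ (homOfLE (leOfHom i)) x⟩ } :
      Subfunctor (above Y C)))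

/-! The internal language: a formula in context `Γ` is interpreted as a subobject of `Γ`,
and the connectives and quantifiers follow the Kripke-Joyal clauses. -/

/-- The formula `x ∈ U` in the context `(U, x) : Ω^X × X`. -/
def mem (X : Topos P) : Subfunctor (FunctorToTypes.prod (Pow X) X) where
  obj C := {t | t.2 ∈ Subfunctor.obj (F := above X C) t.1 ⟨C, le_refl C⟩}
  map {C D} i := fun t ht =>
    Subfunctor.map (F := above X C) t.1 (U := ⟨C, le_refl C⟩) (V := ⟨D, leOfHom i⟩)
      (homOfLE (leOfHom i)) ht

/-- Implication `φ ⇒ ψ`. -/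
def imp {Γ : Topos P} (φ ψ : Subfunctor Γ) : Subfunctor Γ where
  obj C := {t | ∀ (D : P) (h : C ≤ D),
    Γ.map (homOfLE h) t ∈ φ.obj D → Γ.map (homOfLE h) t ∈ ψ.obj D}
  map {C D} i := by
    intro t ht E h
    have key : Γ.map (homOfLE h) (Γ.map i t) = Γ.map (homOfLE ((leOfHom i).trans h)) t := by
      rw [← Functor.map_comp_apply]; rfl
    rw [key]
    exact ht E _

/-- Universal quantification `∀ x : X, φ`. -/
def all {Γ X : Topos P} (φ : Subfunctor (FunctorToTypes.prod Γ X)) : Subfunctor Γ where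
  obj C := {t | ∀ (D : P) (h : C ≤ D) (x : X.obj D), (Γ.map (homOfLE h) t, x) ∈ φ.obj D}
  map {C D} i := by
    intro t ht E h x
    have key : Γ.map (homOfLE h) (Γ.map i t) = Γ.map (homOfLE ((leOfHom i).trans h)) t := by
      rw [← Functor.map_comp_apply]; rfl
    rw [key]
    exact ht E _ x

/-- Existential quantification `∃ x : X, φ`. -/
def ex {Γ X : Topos P} (φ : Subfunctor (FunctorToTypes.prod Γ X)) : Subfunctor Γ where
  obj C := {t | ∃ x : X.obj C, (t, x) ∈ φ.obj C}
  map {C D} i := by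
    rintro t ⟨x, hx⟩
    exact ⟨X.map i x, φ.map i hx⟩

/-- For a relation `◁` between `X` and `Ω^X`, given as a formula in the context
`(U, x) : Ω^X × X`, the object `ℱ(X, ◁)` is the subobject `{U | ∀ x, x ◁ U ⇒ x ∈ U}` of `Ω^X`. -/
def generatedFrame {X : Topos P} (cov : Subfunctor (FunctorToTypes.prod (Pow X) X)) :
    Subfunctor (Pow X) :=
  all (imp cov (mem X))

/-! ## Internal frames -/

/-- An internal frame in `Sets^P`: an internal poset with (natural) finite meets, an internal
join operation `Ω^F ⟶ F`, and the distributive law, in the form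
`(∀ u ∈ U, x ∧ u ≤ y) ⇒ x ∧ ⋁ U ≤ y`. -/
class InternalFrame (F : Topos P) where
  lattice : ∀ C : P, SemilatticeInf (F.obj C)
  top : ∀ C : P, F.obj C
  sup : Pow F ⟶ F
  le_top : ∀ (C : P) (x : F.obj C), x ≤ top C
  map_inf : ∀ {C D : P} (f : C ⟶ D) (x y : F.obj C), F.map f (x ⊓ y) = F.map f x ⊓ F.map f y
  map_top : ∀ {C D : P} (f : C ⟶ D), F.map f (top C) = top D
  sup_le_iff : ∀ (C : P) (U : Subfunctor (above F C)) (y : F.obj C),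
    sup.app C U ≤ y ↔
      ∀ (D : P) (h : C ≤ D), ∀ u ∈ U.obj ⟨D, h⟩, (u : F.obj D) ≤ F.map (homOfLE h) y
  inf_sup_le : ∀ (C : P) (x : F.obj C) (U : Subfunctor (above F C)) (y : F.obj C),
    (∀ (D : P) (h : C ≤ D), ∀ u ∈ U.obj ⟨D, h⟩,
      F.map (homOfLE h) x ⊓ (u : F.obj D) ≤ F.map (homOfLE h) y) →
    x ⊓ sup.app C U ≤ y

namespace InternalFrame

/-- The subobject of `F` at stage `C` generated by a set of elements of `F(C)`. -/
def span (F : Topos P) (C : P) (S : Set (F.obj C)) : Subfunctor (above F C) where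
  obj D := {y | ∃ x ∈ S, F.map (homOfLE D.2) x = y}
  map {D E} i := by
    rintro _ ⟨x, hx, rfl⟩
    refine ⟨x, hx, ?_⟩
    change _ = F.map (homOfLE (leOfHom i)) (F.map (homOfLE D.2) x)
    rw [← Functor.map_comp_apply]; rfl

variable (F : Topos P) [InternalFrame F]

theorem map_mono {C D : P} (f : C ⟶ D) {x y : F.obj C} (h : (lattice C).le x y) :
    (lattice D).le (F.map f x) (F.map f y) := by
  let _ := lattice (F := F) C
  let _ := lattice (F := F) D
  have h' : x ⊓ y = x := inf_eq_left.2 h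
  have := map_inf (F := F) f x y
  rw [h'] at this
  exact inf_eq_left.1 this.symm

theorem sup_span_le_iff (C : P) (S : Set (F.obj C)) (y : F.obj C) :
    (lattice C).le ((sup (F := F)).app C (span F C S)) y ↔ ∀ x ∈ S, (lattice C).le x y := by
  rw [sup_le_iff]
  constructor
  · intro h x hx
    have := h C le_rfl x ⟨x, hx, by
      change F.map (𝟙 C) x = x
      simp⟩
    have e : F.map (homOfLE (le_refl C)) y = y := by
      change F.map (𝟙 C) y = y
      simp
    rwa [e] at this
  · rintro h D hD _ ⟨x, hx, rfl⟩
    exact map_mono F _ (h x hx)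

/-- The complete lattice structure on the values of an internal frame: the join of `S ⊆ F(C)` is
the internal join of the subobject at stage `C` generated by `S`. -/
abbrev completeLattice (C : P) : CompleteLattice (F.obj C) :=
  letI := lattice (F := F) C
  letI sS : Set (F.obj C) → F.obj C := fun S => (sup (F := F)).app C (span F C S)
  have hl : ∀ S, ∀ x ∈ S, x ≤ sS S := fun S =>
    (sup_span_le_iff F C S (sS S)).1 (le_refl (sS S))
  have hu : ∀ S y, (∀ x ∈ S, x ≤ y) → sS S ≤ y := fun S y => (sup_span_le_iff F C S y).2
  { lattice (F := F) C with
    sup := fun a b => sS {a, b}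
    le_sup_left := fun a b => hl _ a (by simp)
    le_sup_right := fun a b => hl _ b (by simp)
    sup_le := fun a b c ha hb => hu _ c (by
      rintro x (rfl | rfl)
      · exact ha
      · exact hb)
    sSup := sS
    isLUB_sSup := fun S => ⟨fun x hx => hl S x hx, fun y hy => hu S y fun x hx => hy hx⟩
    sInf := fun S => sS {y | ∀ x ∈ S, y ≤ x}
    isGLB_sInf := fun S => ⟨fun x hx => hu _ x fun y hy => hy x hx,
      fun y hy => hl _ y fun x hx => hy hx⟩
    top := top C
    le_top := fun x => le_top (F := F) C x
    bot := sS ∅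
    bot_le := fun x => hu _ x (by simp) }

/-- The values of an internal frame are frames in the usual sense. -/
instance frame (C : P) : Order.Frame (F.obj C) :=
  letI := completeLattice F C
  Order.Frame.ofMinimalAxioms
    { inf_sSup_le_iSup_inf := by
        intro a S
        refine inf_sup_le C a (span F C S) _ ?_
        rintro D h _ ⟨x, hx, rfl⟩
        rw [← map_inf]
        exact map_mono F _ (le_iSup₂ (f := fun b (_ : b ∈ S) => a ⊓ b) x hx) }

end InternalFrame

/-- Morphisms of internal frames: arrows which preserve finite meets and internal joins. -/
structure IsInternalFrameHom {F G : Topos P} [InternalFrame F] [InternalFrame G]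
    (φ : F ⟶ G) : Prop where
  map_inf : ∀ (C : P) (x y : F.obj C), φ.app C (x ⊓ y) = φ.app C x ⊓ φ.app C y
  map_top : ∀ C : P, φ.app C (⊤ : F.obj C) = (⊤ : G.obj C)
  map_sup : InternalFrame.sup ≫ φ = powMap φ ≫ InternalFrame.sup

/-! ## The external description of an internal frame -/

/-- The value at an Alexandrov open `V` of `P` of the sheaf corresponding to the functor `F`,
i.e. the set of compatible families of elements of `F(D)`, `D ∈ V`. -/
abbrev SheafValue (F : Topos P) (V : Opens (WithUpperSet P)) : Type u :=
  {s : ∀ D : {D : P // WithUpperSet.toUpperSet D ∈ V}, F.obj D.1 //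
    ∀ (D E : {D : P // WithUpperSet.toUpperSet D ∈ V}) (h : D.1 ≤ E.1),
      F.map (homOfLE h) (s D) = s E}

/-- If `P` has a least element, the restriction map `F(P) = F(⊥) → F(V)`. -/
def restrictTo (F : Topos P) [OrderBot P] (V : Opens (WithUpperSet P)) (y : F.obj ⊥) :
    SheafValue F V :=
  ⟨fun D => F.map (homOfLE (bot_le : ⊥ ≤ D.1)) y, fun D E h => by
    rw [← Functor.map_comp_apply]; rfl⟩

/-- The top element of the value at `V` of an internal frame. -/
def topSection (F : Topos P) [InternalFrame F] (V : Opens (WithUpperSet P)) : SheafValue F V :=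
  ⟨fun _ => ⊤, fun _ _ h => InternalFrame.map_top (homOfLE h)⟩

/-- A frame map `π : 𝒪(P) → F(⊥)`, with `P` carrying the Alexandrov topology, is the external
description of the internal frame `F` if `π(V) = L_V(⊤)` for all opens `V`, where
`L_V : F(V) → F(⊥)` is the left adjoint of the restriction map. -/
def IsExternalDescription (F : Topos P) [InternalFrame F] [OrderBot P]
    (π : FrameHom (Opens (WithUpperSet P)) (F.obj ⊥)) : Prop :=
  ∀ V : Opens (WithUpperSet P), ∃ L : SheafValue F V → F.obj ⊥,
    GaloisConnection L (restrictTo F V) ∧ π V = L (topSection F V)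

/-- The basic Alexandrov open `↑D`. -/
def upOpen (D : P) : Opens (WithUpperSet P) :=
  ⟨{E | D ≤ WithUpperSet.ofUpperSet E}, by
    rw [Topology.IsUpperSet.isOpen_iff_isUpperSet]
    intro a b hab ha
    exact le_trans ha hab⟩

end Logic

/-! ## The interval domain in `Sets` -/

/-- Pairs `(p, q)` of rational numbers with `p < q`. -/
@[ext]
structure RatInterval : Type u where
  lo : ℚ
  hi : ℚ
  lt : lo < hi

/-- `(p, q) ≤ (p', q')` iff `p' ≤ p` and `q ≤ q'`. -/
instance : PartialOrder RatInterval.{u} where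
  le i j := j.lo ≤ i.lo ∧ i.hi ≤ j.hi
  le_refl i := ⟨le_refl _, le_refl _⟩
  le_trans i j k h h' := ⟨h'.1.trans h.1, h.2.trans h'.2⟩
  le_antisymm i j h h' := RatInterval.ext (le_antisymm h'.1 h.1) (le_antisymm h.2 h'.2)

/-- The meet semilattice `ℚ ×_< ℚ`, with its added bottom element. -/
abbrev QQ : Type u := WithBot RatInterval.{u}

/-- The relation `p < p' < q' < q` between `(p', q')` and `x = (p, q)`; it never holds for
`x = ⊥`. -/
def Inside (j : RatInterval.{u}) (x : QQ.{u}) : Prop :=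
  ∃ i : RatInterval.{u}, x = (i : QQ) ∧ i.lo < j.lo ∧ j.hi < i.hi

/-- The covering relation `x ◀ S` in `Sets`: one has `⊥ ◀ S` for all `S`, and `(p, q) ◀ S` iff
every `(p', q')` with `p < p' < q' < q` lies below some `(p'', q'') ∈ S`. -/
def Covers (x : QQ.{u}) (S : Set QQ.{u}) : Prop :=
  ∀ j : RatInterval.{u}, Inside j x → ∃ k : RatInterval.{u}, j ≤ k ∧ (k : QQ) ∈ S

/-- The frame `ℱ(ℚ ×_< ℚ, ◀)` in `Sets`, ordered by inclusion. -/
abbrev SetFrame : Type u := {S : Set QQ.{u} // ∀ x, Covers x S → x ∈ S}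

/-- Scott's interval domain: the poset of compact intervals `[a, b]` in `ℝ`, ordered by
reverse inclusion and equipped with the Scott topology. -/
abbrev IR : Type := WithScott (NonemptyInterval ℝ)ᵒᵈ

/-- The set of all intervals `[a, b]` with `p < a` and `b < q`. -/
def basicOpen (i : RatInterval.{u}) : Set IR :=
  {x | (i.lo : ℝ) < (OrderDual.ofDual (WithScott.ofScott x)).fst ∧
    (OrderDual.ofDual (WithScott.ofScott x)).snd < (i.hi : ℝ)}

/-- The subset of `ℚ ×_< ℚ` corresponding to a Scott open `W`: it contains `⊥`, and it
contains `(p, q)` iff `{[a, b] | p < a, b < q} ⊆ W`. -/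
def scottSubset (W : Opens IR) : Set QQ.{u} :=
  {x | ∀ i : RatInterval.{u}, x = (i : QQ) → basicOpen i ⊆ (W : Set IR)}

/-! ## The internal interval domain -/

section Internal

variable (P : Type u) [PartialOrder P]

/-- The context `(U, x, j) : Ω^(ℚ ×_< ℚ) × (ℚ ×_< ℚ) × {(p, q) | p < q}`. -/
abbrev Ctx₁ : Topos P :=
  FunctorToTypes.prod (FunctorToTypes.prod (Pow (const P QQ.{u})) (const P QQ.{u}))
    (const P RatInterval.{u})

/-- The context `(U, x, j, k)`, with `k` of type `{(p, q) | p < q}`. -/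
abbrev Ctx₂ : Topos P := FunctorToTypes.prod (Ctx₁ P) (const P RatInterval.{u})

/-- The formula `j = (p', q')`, `x = (p, q)`, `p < p' < q' < q` in the context `(U, x, j)`. -/
def insideFormula : Subfunctor (Ctx₁ P) where
  obj _ := {t | Inside t.2 t.1.2}
  map _ := fun _ ht => ht

/-- The formula `j ≤ k` in the context `(U, x, j, k)`. -/
def leFormula : Subfunctor (Ctx₂ P) where
  obj _ := {t | LE.le (α := RatInterval.{u}) t.1.2 t.2}
  map _ := fun _ ht => ht

/-- The formula `k ∈ U` in the context `(U, x, j, k)`. -/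
def memFormula : Subfunctor (Ctx₂ P) where
  obj C := {t | (t.1.1.1, WithBot.some (α := RatInterval.{u}) t.2) ∈ (mem (const P QQ.{u})).obj C}
  map i := fun _ ht => (mem (const P QQ.{u})).map i ht

/-- The internal covering relation `x ◀ U`, i.e. the interpretation of the formula
`∀ j, (j inside x ⇒ ∃ k, j ≤ k ∧ k ∈ U)` in the context `(U, x)`. -/
def cover : Subfunctor (FunctorToTypes.prod (Pow (const P QQ.{u})) (const P QQ.{u})) :=
  all (imp (insideFormula P) (ex (leFormula P ⊓ memFormula P)))

/-- The functor `ℱ(ℚ ×_< ℚ, ◀)` in `Sets^P`. -/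
abbrev intervalFrame : Topos P := (generatedFrame (cover P)).toFunctor

variable {P}

/-- The subobject at stage `C` formed by the values `g(i)`, `i ∈ s`, for a subset `s` of `S`. -/
def values {S : Type u} {F : Topos P} (g : const P S ⟶ F) (C : P) (s : Set S) :
    Subfunctor (above F C) where
  obj D := {y | ∃ i ∈ s, g.app D.1 i = y}
  map {D E} f := by
    rintro _ ⟨i, hi, rfl⟩
    exact ⟨i, hi, NatTrans.naturality_apply g (homOfLE (leOfHom f)) i⟩

/-- An interpretation `g` of the generators `(p, q)`, `p < q`, in an internal frame which
satisfies the defining relations of the interval domain: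
`(p₁, q₁) ∧ (p₂, q₂) = (max p₁ p₂, min q₁ q₂)` if `max p₁ p₂ < min q₁ q₂`, and `= ⊥` otherwise;
`(p, q) = ⋁ {(p', q') | p < p' < q' < q}`; `⊤ = ⋁ {(p, q) | p < q}`. -/
structure IsIntervalModel (F : Topos P) [InternalFrame F]
    (g : const P RatInterval.{u} ⟶ F) : Prop where
  inf_eq : ∀ (C : P) (i j k : RatInterval.{u}),
    k.lo = max i.lo j.lo → k.hi = min i.hi j.hi → g.app C i ⊓ g.app C j = g.app C k
  inf_eq_bot : ∀ (C : P) (i j : RatInterval.{u}), min i.hi j.hi ≤ max i.lo j.lo →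
    g.app C i ⊓ g.app C j = (InternalFrame.sup (F := F)).app C (values g C ∅)
  eq_sup : ∀ (C : P) (i : RatInterval.{u}),
    g.app C i = (InternalFrame.sup (F := F)).app C
      (values g C {j | i.lo < j.lo ∧ j.hi < i.hi})
  top_eq : ∀ C : P, (⊤ : F.obj C) = (InternalFrame.sup (F := F)).app C (values g C Set.univ)

/-- `(F, g)` is the frame of the interval domain in `Sets^P`, i.e. the internal frame which is
freely generated by the `(p, q)`, `p < q`, subject to the relations above. -/
def IsIntervalDomain (F : Topos P) [InternalFrame F] (g : const P RatInterval.{u} ⟶ F) : Prop :=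
  IsIntervalModel F g ∧
    ∀ (G : Topos P) [InternalFrame G] (h : const P RatInterval.{u} ⟶ G), IsIntervalModel G h →
      ∃! φ : F ⟶ G, IsInternalFrameHom φ ∧ g ≫ φ = h

/-- The value at `D ≥ C` of an element `U ∈ ℱ(ℚ ×_< ℚ, ◀)(C) ⊆ Sub(ℚ ×_< ℚ|↑C)`. -/
def valueAt {C : P} (U : (intervalFrame P).obj C) (D : P) (h : C ≤ D) : Set QQ.{u} :=
  Subfunctor.obj (F := above (const P QQ.{u}) C) U.1 ⟨D, h⟩

end Internal

end Bohr

namespace Bohr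

/-! ## Saturated subsets of `ℚ ×_< ℚ` -/

/-! Everything reduces to saturated subsets of `ℚ ×_< ℚ` computed stage by stage. The inside
relation and the order on intervals are constant in the stage, while a subfunctor only grows. So the
quantifiers over later stages in the internal covering relation collapse, and an element of the
generated frame at `C` is just a monotone family of saturated sets on `↑C` (`mem_cover`,
`mem_generatedFrame_cover`). Meets are then intersections, joins are saturations of unions, and
distributivity is a statement about plain sets (`inter_saturation_subset`).

For the universal property, a model `g` in an internal frame sends a family `U` to the join of the
`g(i)` with `i ∈ U`. The meet relations together with distributivity give preservation of meets. The
relation expressing a generator as the join of its interior subintervals matches the definition of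
the covering, and gives preservation of joins (`lift_sup`). Uniqueness holds because each element is
the join of the generators below it.

In sets, the intervals `(p, q)` index a basis of the Scott topology. A compact rational interval is
a single point of the domain, so if a union of basic opens contains it, one of them does. This is
why the covering asks for one larger interval rather than a finite cover (`scottSubset_scottOpen`).

Extending a section by `{⊥}`, the least saturated set, outside an upper set gives both the
surjectivity of restriction and the left adjoint in the external description. -/

/-- A subset of `ℚ ×_< ℚ` is saturated if it contains every element which it covers. -/
def IsSaturated (S : Set QQ.{u}) : Prop := ∀ x, Covers x S → x ∈ S

/-- The saturation of a set: the elements which it covers. -/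
def saturation (S : Set QQ.{u}) : Set QQ.{u} := {x | Covers x S}

theorem inside_coe {j i : RatInterval.{u}} :
    Inside j (i : QQ) ↔ i.lo < j.lo ∧ j.hi < i.hi := by
  constructor
  · rintro ⟨k, hk, h⟩
    obtain rfl : i = k := WithBot.coe_injective hk
    exact h
  · exact fun h => ⟨i, rfl, h⟩

theorem not_inside_bot (j : RatInterval.{u}) : ¬ Inside j (⊥ : QQ) := by
  rintro ⟨i, hi, -⟩
  exact WithBot.bot_ne_coe hi

theorem covers_bot (S : Set QQ.{u}) : Covers ⊥ S := fun j hj => (not_inside_bot j hj).elim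

theorem Inside.mono {j : RatInterval.{u}} {x y : QQ.{u}} (h : Inside j x) (hxy : x ≤ y) :
    Inside j y := by
  obtain ⟨i, rfl, h₁, h₂⟩ := h
  obtain ⟨k, rfl, hk⟩ := WithBot.coe_le_iff.1 hxy
  exact inside_coe.2 ⟨hk.1.trans_lt h₁, h₂.trans_le hk.2⟩

theorem Inside.le {j : RatInterval.{u}} {x : QQ.{u}} (h : Inside j x) : (j : QQ) ≤ x := by
  obtain ⟨i, rfl, h₁, h₂⟩ := h
  exact WithBot.coe_le_coe.2 ⟨h₁.le, h₂.le⟩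

theorem exists_inside (i : RatInterval.{u}) : ∃ j : RatInterval.{u}, Inside j (i : QQ) := by
  obtain ⟨a, ha, ha'⟩ := exists_between i.lt
  obtain ⟨b, hb, hb'⟩ := exists_between ha'
  exact ⟨⟨a, b, hb⟩, inside_coe.2 ⟨ha, hb'⟩⟩

theorem Inside.exists_between {j : RatInterval.{u}} {x : QQ.{u}} (h : Inside j x) :
    ∃ k : RatInterval.{u}, Inside j (k : QQ) ∧ Inside k x := by
  obtain ⟨i, rfl, h₁, h₂⟩ := h
  obtain ⟨a, ha, ha'⟩ := _root_.exists_between h₁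
  obtain ⟨b, hb, hb'⟩ := _root_.exists_between h₂
  exact ⟨⟨a, b, (ha'.trans j.lt).trans hb⟩, inside_coe.2 ⟨ha', hb⟩, inside_coe.2 ⟨ha, hb'⟩⟩

theorem Covers.mono {x : QQ.{u}} {S T : Set QQ.{u}} (h : Covers x S) (hST : S ⊆ T) :
    Covers x T := fun j hj =>
  let ⟨k, hk, hkS⟩ := h j hj
  ⟨k, hk, hST hkS⟩

theorem covers_of_le {x y : QQ.{u}} {S : Set QQ.{u}} (hxy : x ≤ y) (hy : y ∈ S) :
    Covers x S := by
  rintro j hj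
  obtain ⟨i, rfl, h₁, h₂⟩ := hj.mono hxy
  exact ⟨i, ⟨h₁.le, h₂.le⟩, hy⟩

theorem subset_saturation (S : Set QQ.{u}) : S ⊆ saturation S :=
  fun _ hx => covers_of_le le_rfl hx

/-- By density of the rationals an interval `k` fits strictly between `j` and `x`. Covering `x`
bounds `k` by an element of the saturation, whose own covering then bounds `j`. -/
theorem isSaturated_saturation (S : Set QQ.{u}) : IsSaturated (saturation S) := by
  intro x hx j hj
  obtain ⟨k, hjk, hkx⟩ := hj.exists_between
  obtain ⟨l, hkl, hl⟩ := hx k hkx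
  exact hl j (hjk.mono (WithBot.coe_le_coe.2 hkl))

theorem saturation_mono {S T : Set QQ.{u}} (h : S ⊆ T) : saturation S ⊆ saturation T :=
  fun _ hx => Covers.mono hx h

theorem saturation_subset {S T : Set QQ.{u}} (hT : IsSaturated T) (h : S ⊆ T) :
    saturation S ⊆ T := fun x hx => hT x (Covers.mono hx h)

theorem IsSaturated.isLowerSet {S : Set QQ.{u}} (hS : IsSaturated S) : IsLowerSet S :=
  fun _ _ hyx hx => hS _ (covers_of_le hyx hx)

theorem IsSaturated.bot_mem {S : Set QQ.{u}} (hS : IsSaturated S) : ⊥ ∈ S :=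
  hS _ (covers_bot S)

theorem isSaturated_univ : IsSaturated (Set.univ : Set QQ.{u}) := fun _ _ => trivial

/-- A proper interval has interior subintervals, and `Covers` asks for a proper interval above each
of them, which `⊥` cannot supply. -/
theorem isSaturated_singleton_bot : IsSaturated ({⊥} : Set QQ.{u}) := by
  intro x hx
  cases x using WithBot.recBotCoe with
  | bot => rfl
  | coe i =>
    obtain ⟨j, hj⟩ := exists_inside i
    obtain ⟨k, -, hk⟩ := hx j hj
    exact (WithBot.coe_ne_bot hk).elim

theorem IsSaturated.inter {S T : Set QQ.{u}} (hS : IsSaturated S) (hT : IsSaturated T) :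
    IsSaturated (S ∩ T) := fun x hx =>
  ⟨hS x (hx.mono Set.inter_subset_left), hT x (hx.mono Set.inter_subset_right)⟩

/-- An interval whose interior subintervals all lie below `i` lies below `i`. -/
theorem isSaturated_Iic (i : RatInterval.{u}) : IsSaturated {x : QQ.{u} | x ≤ (i : QQ)} := by
  intro x hx
  cases x using WithBot.recBotCoe with
  | bot => exact (bot_le : (⊥ : QQ) ≤ i)
  | coe l =>
    have key : ∀ j : RatInterval.{u}, Inside j (l : QQ) → j ≤ i := fun j hj => by
      obtain ⟨k, hjk, hk⟩ := hx j hj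
      exact hjk.trans (WithBot.coe_le_coe.1 hk)
    refine WithBot.coe_le_coe.2 ⟨?_, ?_⟩
    · by_contra! hlt
      -- An interval inside `l` that starts to the left of `i.lo` contradicts `key`; the minimum
      -- with `l.hi` leaves room for its right end.
      obtain ⟨a, ha, ha'⟩ := exists_between (lt_min hlt l.lt)
      obtain ⟨b, hb, hb'⟩ := exists_between (ha'.trans_le (min_le_right _ _))
      have := (key ⟨a, b, hb⟩ (inside_coe.2 ⟨ha, hb'⟩)).1
      exact this.not_gt (ha'.trans_le (min_le_left _ _))
    · by_contra! hlt
      obtain ⟨b, hb, hb'⟩ := exists_between (max_lt hlt l.lt)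
      obtain ⟨a, ha, ha'⟩ := exists_between ((le_max_right _ _).trans_lt hb)
      have := (key ⟨a, b, ha'⟩ (inside_coe.2 ⟨ha, hb'⟩)).2
      exact this.not_gt ((le_max_left _ _).trans_lt hb)

/-- Binary meets distribute over saturations. -/
theorem inter_saturation_subset {S T R : Set QQ.{u}} (hS : IsSaturated S) (hR : IsSaturated R)
    (h : S ∩ {x | ∃ y ∈ T, x ≤ y} ⊆ R) : S ∩ saturation T ⊆ R := by
  rintro x ⟨hxS, hxT⟩
  refine hR x fun j hj => ?_
  obtain ⟨k, hjk, hk⟩ := hxT j hj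
  -- Since `S` is a lower set it contains the interior interval `j` itself, so `j` is its own
  -- witness in `R`.
  exact ⟨j, le_rfl, h ⟨hS.isLowerSet hj.le hxS, _, hk, WithBot.coe_le_coe.2 hjk⟩⟩

/-! ## Scott opens of the interval domain -/

/-- The interval `[a, b]`, as a point of the interval domain. -/
def IR.mk (a b : ℝ) (h : a ≤ b) : IR := WithScott.toScott (OrderDual.toDual ⟨⟨a, b⟩, h⟩)

/-- The left end point. -/
def IR.left (x : IR) : ℝ := (OrderDual.ofDual (WithScott.ofScott x)).fst

/-- The right end point. -/
def IR.right (x : IR) : ℝ := (OrderDual.ofDual (WithScott.ofScott x)).snd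

theorem IR.left_le_right (x : IR) : x.left ≤ x.right :=
  (OrderDual.ofDual (WithScott.ofScott x)).fst_le_snd

theorem IR.le_iff {x y : IR} : x ≤ y ↔ x.left ≤ y.left ∧ y.right ≤ x.right := Iff.rfl

/-- If the supremum of a directed set satisfies a strict bound at one end, some member does too.
Directedness then combines the members found for the two ends. -/
theorem isOpen_basicOpen (i : RatInterval.{u}) : IsOpen (basicOpen i) := by
  rw [Topology.IsScott.isOpen_iff_isUpperSet_and_dirSupInaccOn (D := Set.univ)]
  refine ⟨?_, ?_⟩
  · intro x y hxy hx
    exact ⟨hx.1.trans_le hxy.1, (show y.right ≤ x.right from hxy.2).trans_lt hx.2⟩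
  · intro d _ hne hdir a ha hai
    have hl : ∃ x ∈ d, (i.lo : ℝ) < IR.left x := by
      by_contra! hcon
      have hle : (i.lo : ℝ) ≤ a.right := (hai.1.trans_le a.left_le_right).le
      -- If no left end passes `i.lo`, then `[i.lo, a.right]` bounds `d` from above, so the supremum
      -- `a` cannot start beyond `i.lo`.
      have : a ≤ IR.mk i.lo a.right hle :=
        ha.2 fun x hx => IR.le_iff.2 ⟨hcon x hx, (IR.le_iff.1 (ha.1 hx)).2⟩
      exact (IR.le_iff.1 this).1.not_gt hai.1
    have hr : ∃ x ∈ d, IR.right x < i.hi := by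
      by_contra! hcon
      have hle : a.left ≤ (i.hi : ℝ) := (a.left_le_right.trans_lt hai.2).le
      have : a ≤ IR.mk a.left i.hi hle :=
        ha.2 fun x hx => IR.le_iff.2 ⟨(IR.le_iff.1 (ha.1 hx)).1, hcon x hx⟩
      exact (IR.le_iff.1 this).2.not_gt hai.2
    obtain ⟨x, hx, hxl⟩ := hl
    obtain ⟨y, hy, hyr⟩ := hr
    obtain ⟨z, hz, hxz, hyz⟩ := hdir x hx y hy
    exact ⟨z, hz, hxl.trans_le (IR.le_iff.1 hxz).1, (IR.le_iff.1 hyz).2.trans_lt hyr⟩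

/-- The basic opens form a basis of the Scott topology. -/
theorem exists_basicOpen_subset {W : Set IR} (hW : IsOpen W) {x : IR} (hx : x ∈ W) :
    ∃ i : RatInterval.{u}, x ∈ basicOpen i ∧ basicOpen i ⊆ W := by
  rw [Topology.IsScott.isOpen_iff_isUpperSet_and_dirSupInaccOn (D := Set.univ)] at hW
  obtain ⟨hup, hinacc⟩ := hW
  have hle : ∀ ε : ℝ, 0 < ε → x.left - ε ≤ x.right + ε := fun ε hε => by
    linarith [x.left_le_right]
  -- The symmetric enlargements of `x` are directed with supremum `x`, so one of them lies in `W`.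
  -- Rational end points between it and `x` give the basic open.
  let d : Set IR := {y | ∃ (ε : ℝ) (hε : 0 < ε), y = IR.mk (x.left - ε) (x.right + ε) (hle ε hε)}
  have hlub : IsLUB d x := by
    refine ⟨?_, fun y hy => ?_⟩
    · rintro _ ⟨ε, hε, rfl⟩
      exact IR.le_iff.2 ⟨sub_le_self _ hε.le, le_add_of_nonneg_right hε.le⟩
    · refine IR.le_iff.2 ⟨le_of_forall_pos_le_add fun ε hε => ?_,
        le_of_forall_pos_le_add fun ε hε => (IR.le_iff.1 (hy ⟨ε, hε, rfl⟩)).2⟩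
      exact sub_le_iff_le_add.1 (IR.le_iff.1 (hy ⟨ε, hε, rfl⟩)).1
  have hdir : DirectedOn (· ≤ ·) d := by
    rintro _ ⟨ε, hε, rfl⟩ _ ⟨δ, hδ, rfl⟩
    refine ⟨_, ⟨min ε δ, lt_min hε hδ, rfl⟩, IR.le_iff.2 ⟨?_, ?_⟩, IR.le_iff.2 ⟨?_, ?_⟩⟩
    · exact sub_le_sub_left (min_le_left _ _) _
    · exact add_le_add_right (min_le_left _ _) _
    · exact sub_le_sub_left (min_le_right _ _) _
    · exact add_le_add_right (min_le_right _ _) _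
  obtain ⟨_, ⟨ε, hε, rfl⟩, hyW⟩ := hinacc (Set.mem_univ d) ⟨_, 1, one_pos, rfl⟩ hdir hlub hx
  obtain ⟨p, hp, hp'⟩ := exists_rat_btwn (sub_lt_self x.left hε)
  obtain ⟨q, hq, hq'⟩ := exists_rat_btwn (lt_add_of_pos_right x.right hε)
  have hpq : p < q := by exact_mod_cast (hp'.trans_le x.left_le_right).trans hq
  refine ⟨⟨p, q, hpq⟩, ⟨hp', hq⟩, fun y hy => hup (IR.le_iff.2 ⟨?_, ?_⟩) hyW⟩
  · exact hp.le.trans hy.1.le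
  · exact hy.2.le.trans hq'.le

theorem basicOpen_mono {i j : RatInterval.{u}} (h : i ≤ j) : basicOpen i ⊆ basicOpen j :=
  fun _ hx => ⟨lt_of_le_of_lt (by exact_mod_cast h.1) hx.1,
    lt_of_lt_of_le hx.2 (by exact_mod_cast h.2)⟩

theorem coe_mem_scottSubset {W : Opens IR} {i : RatInterval.{u}} :
    (i : QQ) ∈ scottSubset W ↔ basicOpen i ⊆ (W : Set IR) :=
  ⟨fun h => h i rfl, fun h j hj => by rwa [← WithBot.coe_injective hj]⟩

/-- A compact interval within the open `(p, q)` already lies within a strictly smaller rational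
interval, to which the covering applies. -/
theorem isSaturated_scottSubset (W : Opens IR) : IsSaturated (scottSubset.{u} W) := by
  rintro x hx i rfl y hy
  obtain ⟨p, hp, hp'⟩ := exists_rat_btwn hy.1
  obtain ⟨q, hq, hq'⟩ := exists_rat_btwn hy.2
  have hpq : p < q := by exact_mod_cast (hp'.trans_le (IR.left_le_right y)).trans hq
  obtain ⟨k, hjk, hk⟩ := hx ⟨p, q, hpq⟩
    (inside_coe.2 ⟨by exact_mod_cast hp, by exact_mod_cast hq'⟩)
  exact coe_mem_scottSubset.1 hk (basicOpen_mono hjk ⟨hp', hq⟩)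

/-- The Scott open which corresponds to a subset of `ℚ ×_< ℚ`. -/
def scottOpen (S : Set QQ.{u}) : Opens IR where
  carrier := ⋃ i ∈ {i : RatInterval.{u} | (i : QQ) ∈ S}, basicOpen i
  is_open' := isOpen_biUnion fun i _ => isOpen_basicOpen i

theorem mem_scottOpen {S : Set QQ.{u}} {x : IR} :
    x ∈ scottOpen S ↔ ∃ i : RatInterval.{u}, (i : QQ) ∈ S ∧ x ∈ basicOpen i := by
  change x ∈ ⋃ i ∈ {i : RatInterval.{u} | (i : QQ) ∈ S}, basicOpen i ↔ _
  simp

theorem scottOpen_scottSubset (W : Opens IR) : scottOpen (scottSubset.{u} W) = W := by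
  ext x
  refine mem_scottOpen.trans ⟨fun ⟨i, hi, hx⟩ => coe_mem_scottSubset.1 hi hx, fun hx => ?_⟩
  obtain ⟨i, hxi, hi⟩ := exists_basicOpen_subset W.2 hx
  exact ⟨i, coe_mem_scottSubset.2 hi, hxi⟩

theorem scottSubset_scottOpen {S : Set QQ.{u}} (hS : IsSaturated S) :
    scottSubset (scottOpen S) = S := by
  ext x
  cases x using WithBot.recBotCoe with
  | bot => exact iff_of_true (isSaturated_scottSubset _).bot_mem hS.bot_mem
  | coe i =>
    rw [coe_mem_scottSubset]
    constructor
    · refine fun h => hS _ fun j hj => ?_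
      rw [inside_coe] at hj
      have hlt : (j.lo : ℝ) < j.hi := by exact_mod_cast j.lt
      -- The compact interval `[j.lo, j.hi]` is one point of the domain, so a single basic open of
      -- the union contains it.
      have hmem : IR.mk j.lo j.hi hlt.le ∈ basicOpen i :=
        ⟨Rat.cast_lt.2 hj.1, Rat.cast_lt.2 hj.2⟩
      obtain ⟨k, hk, hjk⟩ := mem_scottOpen.1 (h hmem)
      exact ⟨k, ⟨(Rat.cast_lt.1 hjk.1).le, (Rat.cast_lt.1 hjk.2).le⟩, hk⟩
    · exact fun h x hx => mem_scottOpen.2 ⟨i, h, hx⟩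

theorem scottSubset_subset_iff {W W' : Opens IR} :
    scottSubset.{u} W ⊆ scottSubset W' ↔ W ≤ W' := by
  constructor
  · intro h x hx
    obtain ⟨i, hxi, hi⟩ := exists_basicOpen_subset.{u} W.2 hx
    exact coe_mem_scottSubset.1 (h (coe_mem_scottSubset.2 hi)) hxi
  · exact fun h x hx i hi => (hx i hi).trans h

theorem scottOpen_le_iff {S T : Set QQ.{u}} (hS : IsSaturated S) (hT : IsSaturated T) :
    scottOpen S ≤ scottOpen T ↔ S ⊆ T := by
  rw [← scottSubset_subset_iff.{u}, scottSubset_scottOpen hS, scottSubset_scottOpen hT]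

theorem mem_range_scottSubset {S : Set QQ.{u}} :
    S ∈ Set.range scottSubset.{u} ↔ IsSaturated S :=
  ⟨by rintro ⟨W, rfl⟩; exact isSaturated_scottSubset W,
    fun hS => ⟨_, scottSubset_scottOpen hS⟩⟩

/-- The frame of Scott opens of the interval domain is isomorphic to `ℱ(ℚ ×_< ℚ, ◀)`. -/
def scottIso : Opens IR ≃o SetFrame.{u} where
  toFun W := ⟨scottSubset W, isSaturated_scottSubset W⟩
  invFun S := scottOpen S.1
  left_inv W := scottOpen_scottSubset W
  right_inv S := Subtype.ext (scottSubset_scottOpen S.2)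
  map_rel_iff' := scottSubset_subset_iff

theorem scottOpen_univ : scottOpen (Set.univ : Set QQ.{u}) = ⊤ :=
  top_le_iff.1 fun _ hx =>
    let ⟨i, hi, _⟩ := exists_basicOpen_subset isOpen_univ hx
    mem_scottOpen.2 ⟨i, trivial, hi⟩

theorem scottOpen_singleton_bot : scottOpen ({⊥} : Set QQ.{u}) = ⊥ :=
  le_bot_iff.1 fun _ hx =>
    let ⟨_, hi, _⟩ := mem_scottOpen.1 hx
    (WithBot.coe_ne_bot hi).elim

end Bohr
namespace Bohr

variable {P : Type u} [PartialOrder P]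

/-! ## Joins in internal frames -/

namespace InternalFrame

variable {F : Topos P}

theorem map_self {C : P} (h : C ≤ C) (x : F.obj C) : F.map (homOfLE h) x = x := by
  change F.map (𝟙 C) x = x
  simp

theorem map_map {C D E : P} (h : C ≤ D) (h' : D ≤ E) (x : F.obj C) :
    F.map (homOfLE h') (F.map (homOfLE h) x) = F.map (homOfLE (h.trans h')) x := by
  rw [← Functor.map_comp_apply]; rfl

variable [InternalFrame F]

theorem sup_app_le_iff {C : P} {U : Subfunctor (above F C)} {y : F.obj C} :
    (sup (F := F)).app C U ≤ y ↔
      ∀ (D : P) (h : C ≤ D) (u : F.obj D), u ∈ U.obj ⟨D, h⟩ → u ≤ F.map (homOfLE h) y :=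
  sup_le_iff C U y

theorem map_sup_app {C D : P} (h : C ≤ D) (U : Subfunctor (above F C)) :
    F.map (homOfLE h) ((sup (F := F)).app C U) = (sup (F := F)).app D (truncate h U) :=
  (NatTrans.naturality_apply (sup (F := F)) (homOfLE h) U).symm

theorem le_map_sup_app {C D : P} (h : C ≤ D) {U : Subfunctor (above F C)} {u : F.obj D}
    (hu : u ∈ U.obj ⟨D, h⟩) : u ≤ F.map (homOfLE h) ((sup (F := F)).app C U) :=
  sup_app_le_iff.1 le_rfl D h u hu

theorem le_sup_app {C : P} {U : Subfunctor (above F C)} {u : F.obj C}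
    (hu : u ∈ U.obj ⟨C, le_rfl⟩) : u ≤ (sup (F := F)).app C U := by
  simpa only [map_self] using le_map_sup_app (F := F) (le_refl C) hu

theorem map_le_map {C D : P} (f : C ⟶ D) {x y : F.obj C} (h : x ≤ y) : F.map f x ≤ F.map f y :=
  map_mono F f h

/-- Distributivity is used twice, the second time at a later stage `D`, where naturality turns the
restricted join of `U` into the join of its truncation. -/
theorem sup_app_inf_sup_app_le {C : P} {U V : Subfunctor (above F C)} {y : F.obj C}
    (H : ∀ (D : P) (h : C ≤ D) (u v : F.obj D), u ∈ U.obj ⟨D, h⟩ → v ∈ V.obj ⟨D, h⟩ →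
      u ⊓ v ≤ F.map (homOfLE h) y) :
    (sup (F := F)).app C U ⊓ (sup (F := F)).app C V ≤ y := by
  refine inf_sup_le C _ V y fun D h (v : F.obj D) hv => ?_
  change F.map (homOfLE h) ((sup (F := F)).app C U) ⊓ v ≤ F.map (homOfLE h) y
  rw [map_sup_app, inf_comm]
  refine inf_sup_le D v _ _ fun E h' (u : F.obj E) hu => ?_
  change F.map (homOfLE h') v ⊓ u ≤ _
  rw [map_map, inf_comm]
  exact H E (h.trans h') u _ hu (V.map (U := ⟨D, h⟩) (V := ⟨E, h.trans h'⟩) (homOfLE h') hv)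

end InternalFrame

open InternalFrame

/-! ### Composition of internal frame morphisms and uniqueness of the interval domain -/

namespace IsInternalFrameHom

variable {F G H : Topos P} [InternalFrame F] [InternalFrame G] [InternalFrame H]

theorem map_sup_app {φ : F ⟶ G} (hφ : IsInternalFrameHom φ) (C : P)
    (U : Subfunctor (above F C)) :
    φ.app C ((sup (F := F)).app C U) = (sup (F := G)).app C ((powMap φ).app C U) :=
  congrArg (fun ψ : Pow F ⟶ G => ψ.app C U) hφ.map_sup

theorem powMap_id (F : Topos P) : powMap (𝟙 F) = 𝟙 (Pow F) := by
  ext C U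
  refine Subfunctor.ext (funext fun D => Set.ext fun y => ?_)
  exact ⟨fun ⟨x, hx, hxy⟩ => (show x = y from hxy) ▸ hx, fun hy => ⟨y, hy, rfl⟩⟩

theorem powMap_comp {F G H : Topos P} (φ : F ⟶ G) (ψ : G ⟶ H) :
    powMap (φ ≫ ψ) = powMap φ ≫ powMap ψ := by
  ext C U
  refine Subfunctor.ext (funext fun D => Set.ext fun y => ?_)
  constructor
  · rintro ⟨x, hx, rfl⟩
    exact ⟨_, ⟨x, hx, rfl⟩, rfl⟩
  · rintro ⟨_, ⟨x, hx, rfl⟩, rfl⟩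
    exact ⟨x, hx, rfl⟩

protected theorem id (F : Topos P) [InternalFrame F] : IsInternalFrameHom (𝟙 F) where
  map_inf _ _ _ := rfl
  map_top _ := rfl
  map_sup := by rw [powMap_id, Category.comp_id, Category.id_comp]

protected theorem comp {φ : F ⟶ G} {ψ : G ⟶ H} (hφ : IsInternalFrameHom φ)
    (hψ : IsInternalFrameHom ψ) : IsInternalFrameHom (φ ≫ ψ) where
  map_inf C x y := by
    change ψ.app C (φ.app C (x ⊓ y)) = _
    rw [hφ.map_inf, hψ.map_inf]; rfl
  map_top C := by
    change ψ.app C (φ.app C ⊤) = _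
    rw [hφ.map_top, hψ.map_top]
  map_sup := by
    rw [← Category.assoc, hφ.map_sup, Category.assoc, hψ.map_sup, powMap_comp, Category.assoc]

end IsInternalFrameHom

/-- Two realizations of the interval domain are isomorphic, compatibly with the generators. -/
theorem IsIntervalDomain.exists_iso {F G : Topos P} [InternalFrame F] [InternalFrame G]
    {g : const P RatInterval.{u} ⟶ F} {h : const P RatInterval.{u} ⟶ G}
    (hF : IsIntervalDomain F g) (hG : IsIntervalDomain G h) :
    ∃ Θ : F ≅ G, IsInternalFrameHom Θ.hom ∧ IsInternalFrameHom Θ.inv ∧ g ≫ Θ.hom = h := by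
  obtain ⟨φ, ⟨hφ, hgφ⟩, -⟩ := hF.2 G h hG.1
  obtain ⟨ψ, ⟨hψ, hhψ⟩, -⟩ := hG.2 F g hF.1
  refine ⟨⟨φ, ψ, ?_, ?_⟩, hφ, hψ, hgφ⟩
  · exact (hF.2 F g hF.1).unique ⟨hφ.comp hψ, by rw [← Category.assoc, hgφ, hhψ]⟩
      ⟨.id F, Category.comp_id g⟩
  · exact (hG.2 G h hG.1).unique ⟨hψ.comp hφ, by rw [← Category.assoc, hhψ, hgφ]⟩
      ⟨.id G, Category.comp_id h⟩

/-! ## The internal frame `ℱ(ℚ ×_< ℚ, ◀)` -/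

/-- The inside relation does not depend on the stage, and a witness found at `C` persists at all
later stages. -/
theorem mem_cover {C : P} {U : (Pow (const P QQ.{u})).obj C} {x : QQ.{u}} :
    (U, x) ∈ (cover P).obj C ↔
      Covers x (Subfunctor.obj (F := above (const P QQ.{u}) C) U ⟨C, le_rfl⟩) := by
  constructor
  · exact fun h j hj => h C le_rfl j C le_rfl hj
  · rintro h D hD j E hE hj
    obtain ⟨k, hjk, hk⟩ := h j hj
    exact ⟨k, hjk, Subfunctor.map (F := above (const P QQ.{u}) C) U (U := ⟨C, le_rfl⟩)
      (V := ⟨E, hD.trans hE⟩) (homOfLE (hD.trans hE)) hk⟩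

theorem mem_generatedFrame_cover {C : P} {U : Subfunctor (above (const P QQ.{u}) C)} :
    U ∈ (generatedFrame (cover P)).obj C ↔ ∀ D : Set.Ici C, IsSaturated (U.obj D) := by
  constructor
  · exact fun h D x hx => h D.1 D.2 x D.1 le_rfl (mem_cover.2 hx)
  · intro h D hD x E hE hx
    exact h ⟨E, hD.trans hE⟩ x (mem_cover.1 hx)

namespace intervalFrame

/-- The element of `ℱ(ℚ ×_< ℚ, ◀)(C)` given by a monotone family of saturated subsets. -/
def ofFamily {C : P} (S : ∀ D : P, C ≤ D → Set QQ.{u})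
    (mono : ∀ (D E : P) (h : C ≤ D) (h' : D ≤ E), S D h ⊆ S E (h.trans h'))
    (sat : ∀ (D : P) (h : C ≤ D), IsSaturated (S D h)) : (intervalFrame P).obj C :=
  ⟨{ obj := fun D => S D.1 D.2
     map := fun {D E} i => mono D.1 E.1 D.2 (leOfHom i) },
   mem_generatedFrame_cover.2 fun D => sat D.1 D.2⟩

variable {C : P}

@[simp] theorem valueAt_ofFamily (S : ∀ D : P, C ≤ D → Set QQ.{u}) (mono) (sat) (D : P)
    (h : C ≤ D) : valueAt (ofFamily S mono sat) D h = S D h := rfl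

theorem isSaturated_valueAt (U : (intervalFrame P).obj C) (D : P) (h : C ≤ D) :
    IsSaturated (valueAt U D h) := mem_generatedFrame_cover.1 U.2 ⟨D, h⟩

theorem valueAt_mono (U : (intervalFrame P).obj C) (D E : P) (h : C ≤ D) (h' : D ≤ E) :
    valueAt U D h ⊆ valueAt U E (h.trans h') :=
  Subfunctor.map (F := above (const P QQ.{u}) C) U.1 (U := ⟨D, h⟩) (V := ⟨E, h.trans h'⟩)
    (homOfLE h')

theorem ext_valueAt {U V : (intervalFrame P).obj C}
    (H : ∀ (D : P) (h : C ≤ D), valueAt U D h = valueAt V D h) : U = V :=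
  Subtype.ext (Subfunctor.ext (funext fun D => H D.1 D.2))

theorem valueAt_map {D : P} (f : C ⟶ D) (U : (intervalFrame P).obj C) (E : P) (h : D ≤ E) :
    valueAt ((intervalFrame P).map f U) E h = valueAt U E (le_trans (leOfHom f) h) := rfl

/-- The join of a subobject of `ℱ(ℚ ×_< ℚ, ◀)` is the saturation of its union. -/
def join (C : P) (U : Subfunctor (above (intervalFrame P) C)) : (intervalFrame P).obj C :=
  ofFamily (fun D h => saturation {x | ∃ u ∈ U.obj ⟨D, h⟩, x ∈ valueAt u D le_rfl})
    (fun D E h h' => saturation_mono <| by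
      rintro x ⟨u, hu, hx⟩
      exact ⟨_, U.map (U := ⟨D, h⟩) (V := ⟨E, h.trans h'⟩) (homOfLE h') hu,
        valueAt_mono u D E le_rfl h' hx⟩)
    (fun D h => isSaturated_saturation _)

/-- The internal frame structure of `ℱ(ℚ ×_< ℚ, ◀)`, ordered by inclusion. -/
instance : InternalFrame (intervalFrame P) where
  lattice C :=
    { le := fun U V => ∀ (D : P) (h : C ≤ D), valueAt U D h ⊆ valueAt V D h
      le_refl := fun U D h => subset_rfl
      le_trans := fun U V W h h' D hD => (h D hD).trans (h' D hD)
      le_antisymm := fun U V h h' => ext_valueAt fun D hD => (h D hD).antisymm (h' D hD)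
      inf := fun U V => ofFamily (fun D h => valueAt U D h ∩ valueAt V D h)
        (fun D E h h' => Set.inter_subset_inter (valueAt_mono U D E h h')
          (valueAt_mono V D E h h'))
        (fun D h => (isSaturated_valueAt U D h).inter (isSaturated_valueAt V D h))
      inf_le_left := fun U V D h => Set.inter_subset_left
      inf_le_right := fun U V D h => Set.inter_subset_right
      le_inf := fun U V W h h' D hD => Set.subset_inter (h D hD) (h' D hD) }
  top C := ofFamily (fun _ _ => Set.univ) (fun _ _ _ _ => subset_rfl)
    (fun _ _ => isSaturated_univ)
  sup := { app := fun C => ↾(join C) }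
  le_top _ _ _ _ := Set.subset_univ _
  map_inf _ _ _ := rfl
  map_top _ := rfl
  sup_le_iff C U y := by
    constructor
    -- Restricting `u` along `D ≤ E` keeps it in `U`, so its value at `E` is part of the union
    -- saturated at stage `E`.
    · intro H D h u hu E h' x hx
      exact H E (h.trans h') (subset_saturation _
        ⟨_, U.map (U := ⟨D, h⟩) (V := ⟨E, h.trans h'⟩) (homOfLE h') hu, hx⟩)
    · intro H D h
      refine saturation_subset (isSaturated_valueAt y D h) ?_
      rintro x ⟨u, hu, hx⟩
      exact H D h u hu D le_rfl hx
  inf_sup_le C x U y H D h := by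
    refine inter_saturation_subset (isSaturated_valueAt x D h) (isSaturated_valueAt y D h) ?_
    rintro z ⟨hzx, w, ⟨u, hu, hw⟩, hzw⟩
    exact H D h u hu D le_rfl ⟨hzx, (isSaturated_valueAt u D le_rfl).isLowerSet hzw hw⟩

theorem le_iff {U V : (intervalFrame P).obj C} :
    U ≤ V ↔ ∀ (D : P) (h : C ≤ D), valueAt U D h ⊆ valueAt V D h := Iff.rfl

theorem valueAt_inf (U V : (intervalFrame P).obj C) (D : P) (h : C ≤ D) :
    valueAt (U ⊓ V) D h = valueAt U D h ∩ valueAt V D h := rfl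

theorem valueAt_top (D : P) (h : C ≤ D) :
    valueAt (⊤ : (intervalFrame P).obj C) D h = Set.univ := rfl

theorem valueAt_sup (U : Subfunctor (above (intervalFrame P) C)) (D : P) (h : C ≤ D) :
    valueAt ((InternalFrame.sup (F := intervalFrame P)).app C U) D h =
      saturation {x | ∃ u ∈ U.obj ⟨D, h⟩, x ∈ valueAt u D le_rfl} := rfl

end intervalFrame

end Bohr
namespace Bohr

variable {P : Type u} [PartialOrder P]

open InternalFrame

/-! ## Frame morphisms determined by a model of the interval domain -/

namespace IsIntervalModel

variable {G : Topos P} {g : const P RatInterval.{u} ⟶ G}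

theorem map_app (g : const P RatInterval.{u} ⟶ G) {C D : P} (h : C ≤ D) (i : RatInterval.{u}) :
    G.map (homOfLE h) (g.app C i) = g.app D i :=
  (NatTrans.naturality_apply g (homOfLE h) i).symm

variable [InternalFrame G]

theorem app_mono (hg : IsIntervalModel G g) (C : P) {i j : RatInterval.{u}} (hij : i ≤ j) :
    g.app C i ≤ g.app C j :=
  inf_eq_left.1 (hg.inf_eq C i j i (max_eq_left hij.1).symm (min_eq_left hij.2).symm)

/-- To bound a generator it suffices to bound its interior subintervals, which are exactly what
`Covers` tests. -/
theorem app_le_of_inside (hg : IsIntervalModel G g) {C : P} {i : RatInterval.{u}} {y : G.obj C}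
    (H : ∀ (D : P) (h : C ≤ D) (j : RatInterval.{u}), Inside j (i : QQ) →
      g.app D j ≤ G.map (homOfLE h) y) : g.app C i ≤ y := by
  rw [hg.eq_sup C i]
  refine sup_app_le_iff.2 ?_
  rintro D h _ ⟨j, hj, rfl⟩
  exact H D h j (inside_coe.2 hj)

/-- The generators `g(i)`, `i ∈ U`. -/
def gens (g : const P RatInterval.{u} ⟶ G) {C : P} (U : (intervalFrame P).obj C) :
    Subfunctor (above G C) where
  obj D := {y | ∃ i : RatInterval.{u}, (i : QQ) ∈ valueAt U D.1 D.2 ∧ g.app D.1 i = y}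
  map {D E} f := by
    rintro _ ⟨i, hi, rfl⟩
    exact ⟨i, intervalFrame.valueAt_mono U D.1 E.1 D.2 (leOfHom f) hi,
      NatTrans.naturality_apply g (homOfLE (leOfHom f)) i⟩

/-- The arrow `U ↦ ⋁ {g(i) | i ∈ U}`. -/
def lift (g : const P RatInterval.{u} ⟶ G) : intervalFrame P ⟶ G where
  app C := ↾(fun U => (InternalFrame.sup (F := G)).app C (gens g U))
  naturality C D f := by
    ext U
    exact (map_sup_app (F := G) (leOfHom f) (gens g U)).symm

theorem lift_le_iff {C : P} {U : (intervalFrame P).obj C} {y : G.obj C} :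
    (lift g).app C U ≤ y ↔ ∀ (D : P) (h : C ≤ D) (i : RatInterval.{u}),
      (i : QQ) ∈ valueAt U D h → g.app D i ≤ G.map (homOfLE h) y := by
  refine (sup_app_le_iff (U := gens g U)).trans ⟨fun H D h i hi => H D h _ ⟨i, hi, rfl⟩, ?_⟩
  rintro H D h _ ⟨i, hi, rfl⟩
  exact H D h i hi

theorem le_lift {C : P} {U : (intervalFrame P).obj C} {i : RatInterval.{u}}
    (hi : (i : QQ) ∈ valueAt U C le_rfl) : g.app C i ≤ (lift g).app C U :=
  le_sup_app (U := gens g U) ⟨i, hi, rfl⟩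

theorem map_lift {C D : P} (h : C ≤ D) (U : (intervalFrame P).obj C) :
    G.map (homOfLE h) ((lift g).app C U) = (lift g).app D ((intervalFrame P).map (homOfLE h) U) :=
  (NatTrans.naturality_apply (lift g) (homOfLE h) U).symm

theorem le_map_lift {C D : P} (h : C ≤ D) {U : (intervalFrame P).obj C} {i : RatInterval.{u}}
    (hi : (i : QQ) ∈ valueAt U D h) : g.app D i ≤ G.map (homOfLE h) ((lift g).app C U) := by
  rw [map_lift]
  exact le_lift hi

theorem lift_mono {C : P} {U V : (intervalFrame P).obj C} (h : U ≤ V) :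
    (lift g).app C U ≤ (lift g).app C V :=
  lift_le_iff.2 fun D hD _ hi => le_map_lift hD (intervalFrame.le_iff.1 h D hD hi)

/-- By distributivity only meets of two generators matter. Overlapping intervals meet in a generator
that lies in both lower sets; disjoint ones meet in an empty join. -/
theorem lift_inf (hg : IsIntervalModel G g) (C : P) (U V : (intervalFrame P).obj C) :
    (lift g).app C (U ⊓ V) = (lift g).app C U ⊓ (lift g).app C V := by
  refine le_antisymm (le_inf (lift_mono inf_le_left) (lift_mono inf_le_right)) ?_
  refine sup_app_inf_sup_app_le (U := gens g U) (V := gens g V) ?_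
  rintro D h _ _ ⟨i, hi, rfl⟩ ⟨j, hj, rfl⟩
  rcases lt_or_ge (max i.lo j.lo) (min i.hi j.hi) with hlt | hle
  · rw [hg.inf_eq D i j ⟨_, _, hlt⟩ rfl rfl]
    refine le_map_lift h ⟨?_, ?_⟩
    · exact (intervalFrame.isSaturated_valueAt U D h).isLowerSet
        (WithBot.coe_le_coe.2 ⟨le_max_left _ _, min_le_left _ _⟩) hi
    · exact (intervalFrame.isSaturated_valueAt V D h).isLowerSet
        (WithBot.coe_le_coe.2 ⟨le_max_right _ _, min_le_right _ _⟩) hj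
  · rw [hg.inf_eq_bot D i j hle]
    refine sup_app_le_iff.2 ?_
    rintro E hE _ ⟨k, hk, rfl⟩
    exact hk.elim

theorem lift_top (hg : IsIntervalModel G g) (C : P) :
    (lift g).app C (⊤ : (intervalFrame P).obj C) = (⊤ : G.obj C) := by
  refine top_le_iff.1 ?_
  rw [hg.top_eq C]
  refine sup_app_le_iff.2 ?_
  rintro D h _ ⟨i, -, rfl⟩
  exact le_map_lift h trivial

/-- An interval `i` in the saturated union need not belong to any single `u`, but each interval
inside `i` lies below an element of some `u`, and `g(i)` is the join of these smaller generators. -/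
theorem lift_sup (hg : IsIntervalModel G g) (C : P)
    (U : Subfunctor (above (intervalFrame P) C)) :
    (lift g).app C ((InternalFrame.sup (F := intervalFrame P)).app C U) =
      (InternalFrame.sup (F := G)).app C ((powMap (lift g)).app C U) := by
  refine le_antisymm (lift_le_iff.2 fun D h i hi => ?_) (sup_app_le_iff.2 ?_)
  · refine hg.app_le_of_inside fun E h' j hj => ?_
    obtain ⟨k, hjk, u, hu, hk⟩ := hi j hj
    refine (hg.app_mono E hjk).trans ?_
    rw [map_map, ← map_app g h']
    refine (map_le_map (F := G) (homOfLE h') (le_lift hk)).trans ?_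
    rw [← map_map h h']
    exact map_le_map _ (le_map_sup_app h ⟨u, hu, rfl⟩)
  · rintro D h _ ⟨u, hu, rfl⟩
    change (lift g).app D u ≤ _
    rw [map_lift]
    exact lift_mono (le_map_sup_app (F := intervalFrame P) h hu)

theorem isInternalFrameHom_lift (hg : IsIntervalModel G g) : IsInternalFrameHom (lift g) where
  map_inf := hg.lift_inf
  map_top := hg.lift_top
  map_sup := by
    ext C U
    exact hg.lift_sup C U

end IsIntervalModel

/-! ## The universal property -/

namespace intervalFrame

/-- The generators `i ↦ ↓ i` of `ℱ(ℚ ×_< ℚ, ◀)`. -/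
def gen (P : Type u) [PartialOrder P] : const P RatInterval.{u} ⟶ intervalFrame P where
  app C := ↾(fun i : RatInterval.{u} => (ofFamily (fun _ _ => {x | x ≤ (i : QQ)})
    (fun _ _ _ _ => subset_rfl) (fun _ _ => isSaturated_Iic i) : (intervalFrame P).obj C))

theorem valueAt_gen {C : P} (i : RatInterval.{u}) (D : P) (h : C ≤ D) :
    valueAt ((gen P).app C i) D h = {x | x ≤ (i : QQ)} := rfl

theorem valueAt_sup_values {C : P} (s : Set RatInterval.{u}) (D : P) (h : C ≤ D) :
    valueAt ((InternalFrame.sup (F := intervalFrame P)).app C (values (gen P) C s)) D h =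
      saturation {x | ∃ i ∈ s, x ≤ (i : QQ)} := by
  rw [valueAt_sup]
  congr 1
  ext x
  constructor
  · rintro ⟨_, ⟨i, hi, rfl⟩, hx⟩
    exact ⟨i, hi, hx⟩
  · rintro ⟨i, hi, hx⟩
    exact ⟨_, ⟨i, hi, rfl⟩, hx⟩

theorem isIntervalModel_gen : IsIntervalModel (intervalFrame P) (gen P) where
  inf_eq C i j k hlo hhi := by
    refine ext_valueAt fun D h => ?_
    rw [valueAt_inf]
    ext x
    simp only [valueAt_gen, Set.mem_inter_iff, Set.mem_ofPred_eq]
    cases x using WithBot.recBotCoe with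
    | bot => simp
    | coe l =>
      simp only [WithBot.coe_le_coe]
      change (i.lo ≤ l.lo ∧ l.hi ≤ i.hi) ∧ (j.lo ≤ l.lo ∧ l.hi ≤ j.hi) ↔
        k.lo ≤ l.lo ∧ l.hi ≤ k.hi
      rw [hlo, hhi, max_le_iff, le_min_iff]
      tauto
  inf_eq_bot C i j hle := by
    refine ext_valueAt fun D h => ?_
    rw [valueAt_inf, valueAt_sup_values]
    refine subset_antisymm ?_ ?_
    · rintro x ⟨hxi, hxj⟩
      rw [valueAt_gen] at hxi hxj
      cases x using WithBot.recBotCoe with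
      | bot => exact covers_bot _
      | coe l =>
        have hi := WithBot.coe_le_coe.1 hxi
        have hj := WithBot.coe_le_coe.1 hxj
        exact ((l.lt.trans_le (le_min hi.2 hj.2)).not_ge
          (hle.trans (max_le hi.1 hj.1))).elim
    · refine saturation_subset ((isSaturated_Iic i).inter (isSaturated_Iic j)) ?_
      rintro x ⟨k, hk, -⟩
      exact hk.elim
  eq_sup C i := by
    refine ext_valueAt fun D h => ?_
    rw [valueAt_sup_values, valueAt_gen]
    refine subset_antisymm (fun x hx j hj => ?_) (saturation_subset (isSaturated_Iic i) ?_)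
    · exact ⟨j, le_rfl, j, inside_coe.1 (hj.mono hx), le_rfl⟩
    · rintro x ⟨j, hj, hx⟩
      exact hx.trans (Inside.le (inside_coe.2 hj))
  top_eq C := by
    refine ext_valueAt fun D h => ?_
    rw [valueAt_sup_values, valueAt_top]
    exact (Set.eq_univ_of_forall fun x j _ => ⟨j, le_rfl, j, trivial, le_rfl⟩).symm

/-- Every element of `ℱ(ℚ ×_< ℚ, ◀)` is the join of the generators below it. -/
theorem sup_gens_gen {C : P} (U : (intervalFrame P).obj C) :
    (InternalFrame.sup (F := intervalFrame P)).app C (IsIntervalModel.gens (gen P) U) = U := by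
  refine ext_valueAt fun D h => ?_
  rw [valueAt_sup]
  refine subset_antisymm (saturation_subset (isSaturated_valueAt U D h) ?_) fun x hx j hj => ?_
  · rintro x ⟨_, ⟨i, hi, rfl⟩, hx⟩
    exact (isSaturated_valueAt U D h).isLowerSet hx hi
  · exact ⟨j, le_rfl, _, ⟨j, (isSaturated_valueAt U D h).isLowerSet hj.le hx, rfl⟩,
      (le_rfl : (j : QQ) ≤ j)⟩

theorem gen_comp_lift {G : Topos P} [InternalFrame G] {g : const P RatInterval.{u} ⟶ G}
    (hg : IsIntervalModel G g) : gen P ≫ IsIntervalModel.lift g = g := by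
  ext C i
  change (IsIntervalModel.lift g).app C ((gen P).app C i) = g.app C i
  refine le_antisymm (IsIntervalModel.lift_le_iff.2 fun D h j hj => ?_)
    (IsIntervalModel.le_lift (le_refl (WithBot.some (α := RatInterval.{u}) i)))
  rw [IsIntervalModel.map_app]
  exact hg.app_mono D (WithBot.coe_le_coe.1 hj)

/-- Elements are joins of generators and `φ` preserves internal joins, so its values on generators
determine it. -/
theorem eq_lift {G : Topos P} [InternalFrame G] {g : const P RatInterval.{u} ⟶ G}
    {φ : intervalFrame P ⟶ G} (hφ : IsInternalFrameHom φ) (hg : gen P ≫ φ = g) :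
    φ = IsIntervalModel.lift g := by
  ext C U
  have happ : ∀ (D : P) (i : RatInterval.{u}), φ.app D ((gen P).app D i) = g.app D i :=
    fun D i => congrArg (fun ψ : const P RatInterval.{u} ⟶ G => ψ.app D i) hg
  change φ.app C U = _
  refine (congrArg (φ.app C) (sup_gens_gen U).symm).trans ((hφ.map_sup_app C _).trans ?_)
  change _ = (InternalFrame.sup (F := G)).app C (IsIntervalModel.gens g U)
  congr 1
  refine Subfunctor.ext (funext fun D => Set.ext fun y => ?_)
  constructor
  · rintro ⟨_, ⟨i, hi, rfl⟩, rfl⟩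
    exact ⟨i, hi, (happ D.1 i).symm⟩
  · rintro ⟨i, hi, rfl⟩
    exact ⟨_, ⟨i, hi, rfl⟩, happ D.1 i⟩

theorem isIntervalDomain : IsIntervalDomain (intervalFrame P) (gen P) :=
  ⟨isIntervalModel_gen, fun _ _ g hg => ⟨IsIntervalModel.lift g,
    ⟨hg.isInternalFrameHom_lift, gen_comp_lift hg⟩, fun _ hφ => eq_lift hφ.1 hφ.2⟩⟩

/-! ## Global elements and the external description -/

section OrderBot

variable [OrderBot P]

theorem exists_map_eq {C : P} (U : (intervalFrame P).obj C) :
    ∃ S : (intervalFrame P).obj ⊥, (intervalFrame P).map (homOfLE bot_le) S = U := by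
  classical
  -- The default is `{⊥}` rather than `∅`: every saturated set contains `⊥`, so `{⊥}` is the least
  -- one and the family stays monotone on entering `↑C`.
  refine ⟨ofFamily (fun D _ => if h : C ≤ D then valueAt U D h else {⊥}) ?_ ?_, ?_⟩
  · intro D E _ h'
    by_cases h : C ≤ D
    · simpa only [dif_pos h, dif_pos (h.trans h')] using valueAt_mono U D E h h'
    · rw [dif_neg h, Set.singleton_subset_iff]
      split_ifs with hE
      · exact (isSaturated_valueAt U E hE).bot_mem
      · rfl
  · intro D _
    split_ifs with h
    · exact isSaturated_valueAt U D h
    · exact isSaturated_singleton_bot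
  · refine ext_valueAt fun D h => ?_
    rw [valueAt_map, valueAt_ofFamily, dif_pos h]

/-- The elements of `ℱ(ℚ ×_< ℚ, ◀)(⊥)` are the subfunctors of `ℚ ×_< ℚ` whose values
correspond to Scott opens. -/
def globalSubfunctor : (intervalFrame P).obj ⊥ ≃o
    {S : Subfunctor (const P QQ.{u}) // ∀ C, S.obj C ∈ Set.range scottSubset.{u}} where
  toFun U := ⟨{ obj := fun C => valueAt U C bot_le
                map := fun {C D} i => valueAt_mono U C D bot_le (leOfHom i) },
    fun C => mem_range_scottSubset.2 (isSaturated_valueAt U C bot_le)⟩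
  invFun S := ofFamily (fun D _ => S.1.obj D) (fun _ _ _ h' => S.1.map (homOfLE h'))
    (fun D _ => mem_range_scottSubset.1 (S.2 D))
  left_inv _ := rfl
  right_inv _ := rfl
  map_rel_iff' := ⟨fun h D _ => h D, fun h D => h D bot_le⟩

/-- The elements of `ℱ(ℚ ×_< ℚ, ◀)(⊥)` are the monotone maps to the frame of Scott opens. -/
def globalMonotone : (intervalFrame P).obj ⊥ ≃o (P →o Opens IR) where
  toFun U :=
    { toFun := fun C => scottOpen (valueAt U C bot_le)
      monotone' := fun C D h => (scottOpen_le_iff (isSaturated_valueAt U C bot_le)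
        (isSaturated_valueAt U D bot_le)).2 (valueAt_mono U C D bot_le h) }
  invFun f := ofFamily (fun D _ => scottSubset (f D))
    (fun _ _ _ h' => scottSubset_subset_iff.2 (f.monotone h'))
    (fun D _ => isSaturated_scottSubset (f D))
  left_inv U := ext_valueAt fun D _ => scottSubset_scottOpen (isSaturated_valueAt U D bot_le)
  right_inv f := OrderHom.ext _ _ (funext fun D => scottOpen_scottSubset (f D))
  map_rel_iff' {U V} := by
    refine ⟨fun h D _ => ?_, fun h D => ?_⟩
    · exact (scottOpen_le_iff (isSaturated_valueAt U D bot_le)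
        (isSaturated_valueAt V D bot_le)).1 (h D)
    · exact (scottOpen_le_iff (isSaturated_valueAt U D bot_le)
        (isSaturated_valueAt V D bot_le)).2 (h D bot_le)

theorem globalMonotone_apply (U : (intervalFrame P).obj ⊥) (C : P) :
    globalMonotone U C = scottOpen (valueAt U C bot_le) := rfl

open Classical in
/-- Extension by `⊥` of a section over an open `V`. -/
noncomputable def extend (V : Opens (WithUpperSet P)) (s : SheafValue (intervalFrame P) V) :
    (intervalFrame P).obj ⊥ :=
  ofFamily (fun D _ => if h : WithUpperSet.toUpperSet D ∈ V then valueAt (s.1 ⟨D, h⟩) D le_rfl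
      else {⊥})
    (by
      intro D E _ h'
      by_cases h : WithUpperSet.toUpperSet D ∈ V
      · have hE : WithUpperSet.toUpperSet E ∈ V :=
          (Topology.IsUpperSet.isOpen_iff_isUpperSet.1 V.2) h' h
        rw [dif_pos h, dif_pos hE, ← s.2 ⟨D, h⟩ ⟨E, hE⟩ h']
        exact valueAt_mono _ D E le_rfl h'
      · rw [dif_neg h, Set.singleton_subset_iff]
        split_ifs with hE
        · exact (isSaturated_valueAt _ E le_rfl).bot_mem
        · rfl)
    (by
      intro D _
      dsimp only
      split_ifs with h
      · exact isSaturated_valueAt _ D le_rfl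
      · exact isSaturated_singleton_bot)

theorem valueAt_extend_of_mem {V : Opens (WithUpperSet P)} (s : SheafValue (intervalFrame P) V)
    {D : P} (h : WithUpperSet.toUpperSet D ∈ V) :
    valueAt (extend V s) D bot_le = valueAt (s.1 ⟨D, h⟩) D le_rfl := dif_pos h

theorem valueAt_extend_of_notMem {V : Opens (WithUpperSet P)}
    (s : SheafValue (intervalFrame P) V) {D : P} (h : WithUpperSet.toUpperSet D ∉ V) :
    valueAt (extend V s) D bot_le = {⊥} := dif_neg h

/-- Outside `V` the extension is least and imposes no condition. Inside `V`, compatibility of the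
section makes the comparison at each point's own stage equivalent to the comparison at all later
stages. -/
theorem gc_extend_restrictTo (V : Opens (WithUpperSet P)) :
    GaloisConnection (extend V) (restrictTo (intervalFrame P) V) := by
  intro s y
  constructor
  · rintro H ⟨D, hD⟩ E hE
    have hEV : WithUpperSet.toUpperSet E ∈ V :=
      (Topology.IsUpperSet.isOpen_iff_isUpperSet.1 V.2) hE hD
    have := le_iff.1 H E bot_le
    rw [valueAt_extend_of_mem s hEV, ← s.2 ⟨D, hD⟩ ⟨E, hEV⟩ hE] at this
    exact this
  · intro H D _
    by_cases hD : WithUpperSet.toUpperSet D ∈ V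
    · rw [valueAt_extend_of_mem s hD]
      exact le_iff.1 (H ⟨D, hD⟩) D le_rfl
    · rw [valueAt_extend_of_notMem s hD, Set.singleton_subset_iff]
      exact (isSaturated_valueAt y D _).bot_mem

theorem extend_topSection_le_iff {V : Opens (WithUpperSet P)} {y : (intervalFrame P).obj ⊥} :
    extend V (topSection (intervalFrame P) V) ≤ y ↔
      ∀ D : P, WithUpperSet.toUpperSet D ∈ V → valueAt y D bot_le = Set.univ := by
  rw [gc_extend_restrictTo V _ y]
  constructor
  · exact fun H D hD => Set.univ_subset_iff.1 (le_iff.1 (H ⟨D, hD⟩) D le_rfl)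
  · rintro H ⟨D, hD⟩ E hE
    have hEV : WithUpperSet.toUpperSet E ∈ V :=
      (Topology.IsUpperSet.isOpen_iff_isUpperSet.1 V.2) hE hD
    exact (H E hEV).symm.subset

theorem valueAt_extend_topSection_of_mem {V : Opens (WithUpperSet P)} {D : P}
    (h : WithUpperSet.toUpperSet D ∈ V) :
    valueAt (extend V (topSection (intervalFrame P) V)) D bot_le = Set.univ :=
  valueAt_extend_of_mem _ h

/-- The external description of `ℱ(ℚ ×_< ℚ, ◀)`. -/
noncomputable def external (P : Type u) [PartialOrder P] [OrderBot P] :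
    FrameHom (Opens (WithUpperSet P)) ((intervalFrame P).obj ⊥) where
  toFun V := extend V (topSection (intervalFrame P) V)
  map_inf' V W := by
    refine ext_valueAt fun D _ => ?_
    have hmem : WithUpperSet.toUpperSet D ∈ V ⊓ W ↔ WithUpperSet.toUpperSet D ∈ V ∧
        WithUpperSet.toUpperSet D ∈ W := Iff.rfl
    rw [valueAt_inf]
    by_cases hV : WithUpperSet.toUpperSet D ∈ V
    · by_cases hW : WithUpperSet.toUpperSet D ∈ W
      · rw [valueAt_extend_topSection_of_mem hV, valueAt_extend_topSection_of_mem hW,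
          valueAt_extend_topSection_of_mem (hmem.2 ⟨hV, hW⟩), Set.univ_inter]
      · rw [valueAt_extend_topSection_of_mem hV, valueAt_extend_of_notMem _ hW,
          valueAt_extend_of_notMem _ fun h => hW (hmem.1 h).2, Set.univ_inter]
    · rw [valueAt_extend_of_notMem _ hV, valueAt_extend_of_notMem _ fun h => hV (hmem.1 h).1]
      exact (Set.inter_eq_left.2
        (Set.singleton_subset_iff.2 (isSaturated_valueAt _ D _).bot_mem)).symm
  map_top' := ext_valueAt fun D _ => valueAt_extend_topSection_of_mem trivial
  map_sSup' 𝒱 := by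
    -- Both sides have the same upper bounds: those equal to the whole set at every point of the
    -- union of `𝒱`.
    refine eq_of_forall_ge_iff fun y => ?_
    rw [sSup_le_iff, Set.forall_mem_image, extend_topSection_le_iff]
    constructor
    · exact fun H V hV => extend_topSection_le_iff.2 fun D hD =>
        H D (Opens.mem_sSup.2 ⟨V, hV, hD⟩)
    · intro H D hD
      obtain ⟨V, hV, hDV⟩ := Opens.mem_sSup.1 hD
      exact extend_topSection_le_iff.1 (H hV) D hDV

theorem isExternalDescription_external :
    IsExternalDescription (intervalFrame P) (external P) := fun V =>
  ⟨extend V, gc_extend_restrictTo V, rfl⟩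

theorem globalMonotone_external_upOpen_of_le {D E : P} (h : D ≤ E) :
    globalMonotone (external P (upOpen D)) E = ⊤ := by
  rw [globalMonotone_apply]
  exact (congrArg scottOpen (valueAt_extend_topSection_of_mem (V := upOpen D) h)).trans
    scottOpen_univ

theorem globalMonotone_external_upOpen_of_not_le {D E : P} (h : ¬ D ≤ E) :
    globalMonotone (external P (upOpen D)) E = ⊥ := by
  rw [globalMonotone_apply]
  exact (congrArg scottOpen (valueAt_extend_of_notMem (V := upOpen D) _ h)).trans
    scottOpen_singleton_bot

end OrderBot

end intervalFrame

end Bohr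

theorem propositionA14 (A : Type u) [CStarAlgebra A] :
    ∃ (_ : Bohr.InternalFrame (Bohr.intervalFrame (Bohr.Context A)))
      (γ : Bohr.const (Bohr.Context A) Bohr.RatInterval.{u} ⟶
        Bohr.intervalFrame (Bohr.Context A)),
      -- the order of the internal frame is inclusion, the generator `i` is sent to `↓ i`
      (∀ (C : Bohr.Context A) (U V : (Bohr.intervalFrame (Bohr.Context A)).obj C),
        U ≤ V ↔ ∀ (D : Bohr.Context A) (h : C ≤ D), Bohr.valueAt U D h ⊆ Bohr.valueAt V D h) ∧
      (∀ (C : Bohr.Context A) (i : Bohr.RatInterval.{u}) (D : Bohr.Context A) (h : C ≤ D),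
        Bohr.valueAt (γ.app C i) D h = {x : Bohr.QQ.{u} | x ≤ (i : Bohr.QQ)}) ∧
      -- it is the interval domain of the topos, to which any other realization is isomorphic
      Bohr.IsIntervalDomain (Bohr.intervalFrame (Bohr.Context A)) γ ∧
      (∀ (F : Bohr.Topos (Bohr.Context A)) [Bohr.InternalFrame F]
        (g : Bohr.const (Bohr.Context A) Bohr.RatInterval.{u} ⟶ F), Bohr.IsIntervalDomain F g →
        ∃ Θ : F ≅ Bohr.intervalFrame (Bohr.Context A),
          Bohr.IsInternalFrameHom Θ.hom ∧ Bohr.IsInternalFrameHom Θ.inv ∧ g ≫ Θ.hom = γ) ∧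
      -- the frame of Scott opens, as a set of subsets of `ℚ ×_< ℚ`
      (∃ ν : Opens Bohr.IR ≃o Bohr.SetFrame.{u}, ∀ W, (ν W).1 = Bohr.scottSubset.{u} W) ∧
      -- the values at all contexts, and the restriction maps
      (∀ (C : Bohr.Context A)
        (U : Subfunctor (Bohr.above (Bohr.const (Bohr.Context A) Bohr.QQ.{u}) C)),
        U ∈ (Bohr.generatedFrame (Bohr.cover (Bohr.Context A))).obj C ↔
          ∀ D : Set.Ici C, U.obj D ∈ Set.range Bohr.scottSubset.{u}) ∧
      (∀ (C D : Bohr.Context A) (f : C ⟶ D)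
        (U : (Bohr.intervalFrame (Bohr.Context A)).obj C) (E : Bohr.Context A) (h : D ≤ E),
        Bohr.valueAt ((Bohr.intervalFrame (Bohr.Context A)).map f U) E h =
          Bohr.valueAt U E (le_trans (leOfHom f) h)) ∧
      (∀ (C : Bohr.Context A) (U : (Bohr.intervalFrame (Bohr.Context A)).obj C),
        ∃ S : (Bohr.intervalFrame (Bohr.Context A)).obj ⊥,
          (Bohr.intervalFrame (Bohr.Context A)).map (homOfLE bot_le) S = U) ∧
      -- the value at `ℂ · 1`
      (∃ e : (Bohr.intervalFrame (Bohr.Context A)).obj ⊥ ≃o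
          {S : Subfunctor (Bohr.const (Bohr.Context A) Bohr.QQ.{u}) //
            ∀ C, S.obj C ∈ Set.range Bohr.scottSubset.{u}},
        ∀ U C, (e U).1.obj C = Bohr.valueAt U C bot_le) ∧
      ∃ m : (Bohr.intervalFrame (Bohr.Context A)).obj ⊥ ≃o (Bohr.Context A →o Opens Bohr.IR),
        (∀ U C, Bohr.scottSubset.{u} (m U C) = Bohr.valueAt U C bot_le) ∧
        -- the external description
        ∃ π : FrameHom (Opens (WithUpperSet (Bohr.Context A)))
            ((Bohr.intervalFrame (Bohr.Context A)).obj ⊥),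
          Bohr.IsExternalDescription (Bohr.intervalFrame (Bohr.Context A)) π ∧
          ∀ D E : Bohr.Context A,
            (D ≤ E → m (π (Bohr.upOpen D)) E = ⊤) ∧
            (¬ D ≤ E → m (π (Bohr.upOpen D)) E = ⊥) := by
  exact ⟨inferInstance, Bohr.intervalFrame.gen _, fun _ _ _ => Iff.rfl, fun _ _ _ _ => rfl,
    Bohr.intervalFrame.isIntervalDomain,
    fun F _ g hg => hg.exists_iso Bohr.intervalFrame.isIntervalDomain,
    ⟨Bohr.scottIso, fun _ => rfl⟩,
    fun C U => Bohr.mem_generatedFrame_cover.trans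
      (forall_congr' fun _ => Bohr.mem_range_scottSubset.symm),
    fun _ _ _ _ _ _ => rfl,
    fun _ U => Bohr.intervalFrame.exists_map_eq U,
    ⟨Bohr.intervalFrame.globalSubfunctor, fun _ _ => rfl⟩,
    Bohr.intervalFrame.globalMonotone,
    fun U C => Bohr.scottSubset_scottOpen (Bohr.intervalFrame.isSaturated_valueAt U C bot_le),
    Bohr.intervalFrame.external _, Bohr.intervalFrame.isExternalDescription_external,
    fun _ _ => ⟨Bohr.intervalFrame.globalMonotone_external_upOpen_of_le,
      Bohr.intervalFrame.globalMonotone_external_upOpen_of_not_le⟩⟩
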